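/- Let $K$ be an algebraically closed field, let $Q$ be a finite acyclic quiver (finitely many vertices and arrows, no oriented cycles), and let $\Lambda=KQ$ be its path algebra. Let $\operatorname{mod}\Lambda$ be the category of finite-dimensional right $\Lambda$-modules, where the product of a path ending at $i$ with a path starting at $i$ is their concatenation. For $M\in\operatorname{mod}\Lambda$ put $${}^\perp M=\{X\in\operatorname{mod}\Lambda\mid \operatorname{Hom}_\Lambda(X,M)=0\},\qquad M^\perp=\{X\in\operatorname{mod}\Lambda\mid \operatorname{Hom}_\Lambda(M,X)=0\},$$ and let $\underline{\dim}\,M=(\dim_K Me_i)_{i\in Q_0}$ be its dimension vector, where $e_i$ is the trivial path at the vertex $i$. A module $B\in\operatorname{mod}\Lambda$ is called a brick if $\operatorname{End}_\Lambda(B)\cong K$; a brick $B$ is called exceptional if $\operatorname{Ext}^1_\Lambda(B,B)=0$. Let $M,N\in\operatorname{mod}\Lambda$, and let $B\in{}^\perp M\cap N^\perp$ be a brick which is not exceptional. Then there exists a brick $B'\in\operatorname{mod}\Lambda$ such that $$B'\in{}^\perp(M\oplus B)\cap(N\oplus B)^\perp\qquad\text{and}\qquad \underline{\dim}\,B'\in\mathbb{Z}_{\ge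 1}\cdot\underline{\dim}\,B .$$ -/

import Mathlib

universe u v w

open CategoryTheory

/-- A path of the quiver `V`, together with its source and its target
(the trivial paths, one for each vertex, are included). -/
structure QPath (V : Type v) [Quiver.{w} V] where
  src : V
  tgt : V
  path : Quiver.Path src tgt

/-- A quiver is acyclic if it has no oriented cycles of positive length. -/
def QuiverAcyclic (V : Type v) [Quiver.{w} V] : Prop :=
  ∀ (i : V) (p : Quiver.Path i i), p.length = 0

/-- The underlying vector space of the path algebra `KV` of a quiver `V`:
the `K`-vector space with basis the set of all paths. -/
def PathAlgebra (K : Type u) (V : Type v) [Quiver.{w} V] [Field K] :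
    Type (max u v w) :=
  QPath.{v, w} V →₀ K

noncomputable section

namespace PathAlgebra

variable (K : Type u) (V : Type v) [Quiver.{w} V] [Field K]

instance : AddCommGroup (PathAlgebra.{u, v, w} K V) :=
  inferInstanceAs (AddCommGroup (QPath.{v, w} V →₀ K))

instance : Module K (PathAlgebra.{u, v, w} K V) :=
  inferInstanceAs (Module K (QPath.{v, w} V →₀ K))

variable {V}

/-- The basis of the path algebra given by the paths. -/
def basis : Module.Basis (QPath.{v, w} V) K (PathAlgebra.{u, v, w} K V) :=
  Module.Basis.ofRepr (LinearEquiv.refl K (QPath.{v, w} V →₀ K))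

/-- The basis element of the path algebra given by a path. -/
def ofPath (p : QPath.{v, w} V) : PathAlgebra.{u, v, w} K V := basis K p

open Classical in
/-- The product of two paths: the concatenation `p q` (first `p`, then `q`) if `p` ends where
`q` starts, and zero otherwise. -/
def pathMul (p q : QPath.{v, w} V) : PathAlgebra.{u, v, w} K V :=
  if h : q.src = p.tgt then ofPath K ⟨p.src, q.tgt, p.path.comp (q.path.cast h rfl)⟩ else 0

/-- The bilinear extension of the product of paths. -/
def mulBilin :
    PathAlgebra.{u, v, w} K V →ₗ[K] PathAlgebra.{u, v, w} K V →ₗ[K] PathAlgebra.{u, v, w} K V :=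
  (basis K).constr K fun p => (basis K).constr K fun q => pathMul K p q

/-- The trivial path at the vertex `i`, an idempotent of the path algebra. -/
def vertex (i : V) : PathAlgebra.{u, v, w} K V := ofPath K ⟨i, i, Quiver.Path.nil⟩

instance : Mul (PathAlgebra.{u, v, w} K V) := ⟨fun a b => mulBilin K a b⟩

instance [Fintype V] : One (PathAlgebra.{u, v, w} K V) := ⟨∑ i : V, vertex K i⟩

variable {K}

theorem mul_def (a b : PathAlgebra.{u, v, w} K V) : a * b = mulBilin K a b := rfl

theorem one_def [Fintype V] : (1 : PathAlgebra.{u, v, w} K V) = ∑ i : V, vertex K i := rfl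

theorem ofPath_mul (p q : QPath.{v, w} V) : ofPath K p * ofPath K q = pathMul K p q := by
  simp only [mul_def, mulBilin, ofPath, Module.Basis.constr_basis]

theorem induction {P : PathAlgebra.{u, v, w} K V → Prop} (a : PathAlgebra.{u, v, w} K V)
    (h0 : P 0) (hadd : ∀ a b, P a → P b → P (a + b))
    (hs : ∀ (c : K) (p : QPath.{v, w} V), P (c • ofPath K p)) : P a := by
  rw [← (basis K).linearCombination_repr a, Finsupp.linearCombination_apply, Finsupp.sum]
  exact Finset.sum_induction _ P hadd h0 fun p _ => hs _ p

theorem mul_add' (a b c : PathAlgebra.{u, v, w} K V) : a * (b + c) = a * b + a * c := by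
  simp [mul_def]

theorem add_mul' (a b c : PathAlgebra.{u, v, w} K V) : (a + b) * c = a * c + b * c := by
  simp [mul_def]

theorem zero_mul' (a : PathAlgebra.{u, v, w} K V) : 0 * a = 0 := by simp [mul_def]

theorem mul_zero' (a : PathAlgebra.{u, v, w} K V) : a * 0 = 0 := by simp [mul_def]

theorem smul_mul' (c : K) (a b : PathAlgebra.{u, v, w} K V) : (c • a) * b = c • (a * b) := by
  simp [mul_def]

theorem mul_smul' (c : K) (a b : PathAlgebra.{u, v, w} K V) : a * (c • b) = c • (a * b) := by
  simp [mul_def]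

theorem pathMul_of_eq {i j k : V} (p : Quiver.Path i j) (q : Quiver.Path j k) :
    pathMul K ⟨i, j, p⟩ ⟨j, k, q⟩ = ofPath K ⟨i, k, p.comp q⟩ := by
  simp [pathMul]

theorem pathMul_of_ne (p q : QPath.{v, w} V) (h : q.src ≠ p.tgt) : pathMul K p q = 0 := by
  simp [pathMul, h]

theorem ofPath_assoc (p q r : QPath.{v, w} V) :
    ofPath K p * ofPath K q * ofPath K r = ofPath K p * (ofPath K q * ofPath K r) := by
  obtain ⟨i, j, p⟩ := p
  obtain ⟨j', k, q⟩ := q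
  obtain ⟨k', l, r⟩ := r
  by_cases h : j' = j
  · subst h
    by_cases h' : k' = k
    · subst h'
      simp only [ofPath_mul, pathMul_of_eq, Quiver.Path.comp_assoc]
    · simp only [ofPath_mul, pathMul_of_eq]
      rw [pathMul_of_ne _ _ (by exact h'), pathMul_of_ne _ _ (by exact h'), mul_zero']
  · rw [ofPath_mul, pathMul_of_ne _ _ (by exact h), zero_mul']
    by_cases h' : k' = k
    · subst h'
      rw [ofPath_mul ⟨j', k', q⟩, pathMul_of_eq, ofPath_mul, pathMul_of_ne _ _ (by exact h)]
    · rw [ofPath_mul ⟨j', k, q⟩, pathMul_of_ne _ _ (by exact h'), mul_zero']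

theorem mul_assoc' (a b c : PathAlgebra.{u, v, w} K V) : a * b * c = a * (b * c) := by
  induction a using induction with
  | h0 => simp only [zero_mul']
  | hadd a a' ha ha' => simp only [add_mul', ha, ha']
  | hs x p =>
    induction b using induction with
    | h0 => simp only [zero_mul', mul_zero']
    | hadd b b' hb hb' => simp only [add_mul', mul_add', hb, hb']
    | hs y q =>
      induction c using induction with
      | h0 => simp only [mul_zero']
      | hadd c c' hc hc' => simp only [mul_add', hc, hc']
      | hs z r => simp only [smul_mul', mul_smul', ofPath_assoc]

theorem one_mul' [Fintype V] (a : PathAlgebra.{u, v, w} K V) : 1 * a = a := by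
  induction a using induction with
  | h0 => exact mul_zero' _
  | hadd a b ha hb => rw [mul_add', ha, hb]
  | hs c p =>
    rw [mul_smul', one_def, mul_def, map_sum, LinearMap.sum_apply]
    rw [Finset.sum_eq_single p.src]
    · rw [← mul_def, vertex, ofPath_mul]
      obtain ⟨i, j, p⟩ := p
      rw [pathMul_of_eq, Quiver.Path.nil_comp]
    · intro i _ hi
      rw [← mul_def, vertex, ofPath_mul, pathMul_of_ne _ _ hi.symm]
    · simp

theorem mul_one' [Fintype V] (a : PathAlgebra.{u, v, w} K V) : a * 1 = a := by
  induction a using induction with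
  | h0 => exact zero_mul' _
  | hadd a b ha hb => rw [add_mul', ha, hb]
  | hs c p =>
    rw [smul_mul', one_def, mul_def, map_sum]
    rw [Finset.sum_eq_single p.tgt]
    · rw [← mul_def, vertex, ofPath_mul]
      obtain ⟨i, j, p⟩ := p
      rw [pathMul_of_eq, Quiver.Path.comp_nil]
    · intro i _ hi
      rw [← mul_def, vertex, ofPath_mul, pathMul_of_ne _ _ hi]
    · simp

/-- The ring structure of the path algebra of a quiver with finitely many vertices. -/
instance [Fintype V] : Ring (PathAlgebra.{u, v, w} K V) where
  __ := (inferInstance : AddCommGroup (PathAlgebra.{u, v, w} K V))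
  mul_assoc := mul_assoc'
  one_mul := one_mul'
  mul_one := mul_one'
  left_distrib := mul_add'
  right_distrib := add_mul'
  zero_mul := zero_mul'
  mul_zero := mul_zero'

instance [Fintype V] : Algebra K (PathAlgebra.{u, v, w} K V) :=
  Algebra.ofModule smul_mul' fun c a b => mul_smul' c a b

end PathAlgebra

/-- An object of `mod KV`: a finite-dimensional right module over the path algebra `KV`.
Right modules are left modules over the opposite algebra. -/
structure FinMod (K : Type u) (V : Type v) [Quiver.{w} V] [Fintype V] [Field K] where
  carrier : Type (max u v w)
  [addCommGroup : AddCommGroup carrier]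
  [moduleBase : Module K carrier]
  [module : Module (PathAlgebra.{u, v, w} K V)ᵐᵒᵖ carrier]
  [isScalarTower : IsScalarTower K (PathAlgebra.{u, v, w} K V)ᵐᵒᵖ carrier]
  [finite : FiniteDimensional K carrier]

namespace FinMod

variable {K : Type u} {V : Type v} [Quiver.{w} V] [Fintype V] [Field K]

instance : CoeSort (FinMod.{u, v, w} K V) (Type (max u v w)) := ⟨carrier⟩

attribute [instance] addCommGroup moduleBase module isScalarTower finite

/-- `Hom(M, N)`: the homomorphisms of right `KV`-modules. -/
abbrev Hom (M N : FinMod.{u, v, w} K V) : Type (max u v w) :=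
  M →ₗ[(PathAlgebra.{u, v, w} K V)ᵐᵒᵖ] N

/-- The direct sum `M ⊕ N`. -/
def directSum (M N : FinMod.{u, v, w} K V) : FinMod.{u, v, w} K V where
  carrier := M × N

/-- The subspace `M e_i` of `M`. -/
def component (M : FinMod.{u, v, w} K V) (i : V) : Submodule K M :=
  LinearMap.range
    (Algebra.lsmul K K (M : Type (max u v w)) (MulOpposite.op (PathAlgebra.vertex K i)))

/-- The dimension vector `(dim_K M e_i)_i` of `M`. -/
def dimVec (M : FinMod.{u, v, w} K V) : V → ℕ := fun i => Module.finrank K (M.component i)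

/-- `B` is a brick if its endomorphism algebra is isomorphic to `K`. -/
def IsBrick (B : FinMod.{u, v, w} K V) : Prop :=
  Nonempty (Module.End (PathAlgebra.{u, v, w} K V)ᵐᵒᵖ B ≃ₐ[K] K)

/-- A brick `B` is exceptional if `Ext¹(B, B) = 0`. -/
def IsExceptional (B : FinMod.{u, v, w} K V) : Prop :=
  B.IsBrick ∧
    Subsingleton (Abelian.Ext (ModuleCat.of (PathAlgebra.{u, v, w} K V)ᵐᵒᵖ B)
      (ModuleCat.of (PathAlgebra.{u, v, w} K V)ᵐᵒᵖ B) 1)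

/-- `⊥M`, the modules `X` with `Hom(X, M) = 0`. -/
def leftPerp (M : FinMod.{u, v, w} K V) : Set (FinMod.{u, v, w} K V) :=
  {X | ∀ f : Hom X M, f = 0}

/-- `M⊥`, the modules `X` with `Hom(M, X) = 0`. -/
def rightPerp (M : FinMod.{u, v, w} K V) : Set (FinMod.{u, v, w} K V) :=
  {X | ∀ f : Hom M X, f = 0}

end FinMod

end

/-! A brick B that is not exceptional has a nontrivial self-extension, and since a path algebra is
free on its arrows over its vertices, this is represented by a family `δ` of maps, one per arrow,
that is not a coboundary (`IsBrick.exists_cocycle`). For every scalar t, letting the arrows act by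
their old action plus t times `δ` gives a module B_t with the dimension vector of B (`deform`). Some
B_t is the required brick, so the multiple is 1.

Hom(B_t, Y), Hom(Y, B_t) and End(B_t) are kernels of pencils f + t g of linear maps, where f
computes the same space for B. A pencil injective at t = 0 is injective for almost all t, which
handles M and N and, after splitting off the scalars, the brick property. For Y = B the kernel at t
= 0 consists of the scalars, but g sends the identity to `δ` or its negative, outside the range of
f. First-order obstruction is enough for injectivity at almost all t
(`LinearMap.finite_setOf_not_injective_add_smul_of_ker`). As K is infinite, one t avoids all the
finite exceptional sets. -/

/-! ### Pencils of linear maps -/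

section Pencil

variable {K U W : Type*} [Field K] [AddCommGroup U] [Module K U] [FiniteDimensional K U]
  [AddCommGroup W] [Module K W]

/-- A pencil of linear maps that is injective at `0` is injective at all but finitely many
parameters. -/
theorem LinearMap.finite_setOf_not_injective_add_smul (f g : U →ₗ[K] W)
    (hf : Function.Injective f) : {t : K | ¬ Function.Injective (f + t • g)}.Finite := by
  obtain ⟨r, hr⟩ := f.exists_leftInverse_of_injective (LinearMap.ker_eq_bot.2 hf)
  have hr' : ∀ u, r (f u) = u := fun u => LinearMap.congr_fun hr u
  -- Applying the retraction `r` to (f + t g) u = 0 gives u + t r(g u) = 0, so -t⁻¹ is an eigenvalue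
  -- of `r ∘ₗ g`.
  have hfin := (Module.End.finite_hasEigenvalue (r ∘ₗ g)).preimage
    (f := fun t : K => -t⁻¹) (fun a _ b _ h => inv_injective (neg_injective h))
  refine hfin.subset fun t ht => ?_
  rw [Set.mem_ofPred_eq, injective_iff_map_eq_zero] at ht
  push Not at ht
  obtain ⟨u, hu, hu0⟩ := ht
  have h1 : u + t • r (g u) = 0 := by
    have := congrArg r hu
    simpa [hr'] using this
  have ht0 : t ≠ 0 := by
    rintro rfl
    exact hu0 (by simpa using h1)
  refine Module.End.hasEigenvalue_of_hasEigenvector (x := u)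
    ⟨Module.End.mem_eigenspace_iff.2 ?_, hu0⟩
  rw [LinearMap.comp_apply, neg_smul, eq_neg_iff_add_eq_zero, ← smul_right_injective U ht0 |>.eq_iff]
  simpa [smul_add, smul_smul, ht0, add_comm] using h1

/-- A pencil `f + t g` of linear maps such that `g` sends no nonzero vector of the kernel of `f`
into the range of `f` is injective at all but finitely many parameters. -/
theorem LinearMap.finite_setOf_not_injective_add_smul_of_ker (f g : U →ₗ[K] W)
    (h : ∀ u w, f u = 0 → g u = f w → u = 0) :
    {t : K | ¬ Function.Injective (f + t • g)}.Finite := by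
  obtain ⟨q, hq⟩ := (LinearMap.ker f).subtype.exists_leftInverse_of_injective
    (Submodule.ker_subtype _)
  set π : U →ₗ[K] U := (LinearMap.ker f).subtype ∘ₗ q with hπ
  have hfπ : ∀ u, f (π u) = 0 := fun u => (q u).2
  have hπk : ∀ u, f u = 0 → π u = u := fun u hu =>
    congrArg Subtype.val (LinearMap.congr_fun hq ⟨u, hu⟩)
  have hππ : ∀ u, π (π u) = π u := fun u => hπk _ (hfπ u)
  -- With `π` a projection onto the kernel of `f`, this map is `g` on the kernel and `f` on the
  -- complement `ker π`; the hypothesis says exactly that the two do not interfere.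
  have hinj : Function.Injective (g ∘ₗ π + f) := by
    rw [injective_iff_map_eq_zero]
    intro u hu
    have h1 : π u = 0 := h (π u) (-u) (hfπ u) (by
      rw [map_neg, eq_neg_iff_add_eq_zero]; exact hu)
    have h2 : f u = 0 := by simpa [h1] using hu
    rw [← hπk u h2, h1]
  refine ((LinearMap.finite_setOf_not_injective_add_smul (g ∘ₗ π + f)
    (g ∘ₗ (LinearMap.id - π)) hinj).union (Set.finite_singleton 0)).subset fun t ht => ?_
  by_contra hcon
  simp only [Set.mem_union, Set.mem_ofPred_eq, Set.mem_singleton_iff, not_or, not_not] at hcon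
  obtain ⟨hcon, ht0⟩ := hcon
  refine ht ?_
  rw [injective_iff_map_eq_zero] at hcon ⊢
  intro x hx
  -- Scaling the kernel component by t turns (f + t g) x into the value at this vector of the pencil
  -- with constant term `g ∘ₗ π + f`. The scaling is invertible only for t ≠ 0, so 0 is added to the
  -- exceptional set.
  have key : t • π x + (x - π x) = 0 := by
    apply hcon
    have hx' : f x + t • g x = 0 := hx
    simp only [LinearMap.add_apply, LinearMap.comp_apply, LinearMap.smul_apply,
      LinearMap.sub_apply, LinearMap.id_apply, map_add, map_sub, map_smul, hππ, hfπ,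
      smul_sub, sub_self, map_zero, smul_zero, add_zero]
    refine Eq.trans ?_ hx'
    abel
  have h1 : π x = 0 := by
    have := congrArg π key
    simpa [hππ, ht0] using this
  simpa [h1] using key

end Pencil

/-! ### Equivariance as a linear condition -/

section Commutator

variable {K : Type*} [Field K] {G X Y : Type*} [AddCommGroup X] [Module K X]
  [AddCommGroup Y] [Module K Y]

/-- The linear map sending `f : X → Y` to the family of the defects `f ρ(g) - σ(g) f` of
equivariance. -/
def equivarianceDefect (ρ : G → Module.End K X) (σ : G → Module.End K Y) :
    (X →ₗ[K] Y) →ₗ[K] (G → X →ₗ[K] Y) :=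
  LinearMap.pi fun g => LinearMap.lcomp K Y (ρ g) - LinearMap.compRight K (σ g)

theorem equivarianceDefect_apply (ρ : G → Module.End K X) (σ : G → Module.End K Y)
    (f : X →ₗ[K] Y) (g : G) :
    equivarianceDefect ρ σ f g = f ∘ₗ ρ g - σ g ∘ₗ f := rfl

/-- The defect depends linearly on the pair of actions, so a linear deformation of actions yields a
pencil. -/
theorem equivarianceDefect_add_smul (ρ ρ' : G → Module.End K X) (σ σ' : G → Module.End K Y)
    (t : K) : equivarianceDefect (ρ + t • ρ') (σ + t • σ') =
      equivarianceDefect ρ σ + t • equivarianceDefect ρ' σ' := by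
  ext f g x
  simp [equivarianceDefect_apply, smul_sub]
  abel

theorem equivarianceDefect_eq_zero_iff {ρ : G → Module.End K X} {σ : G → Module.End K Y}
    {f : X →ₗ[K] Y} : equivarianceDefect ρ σ f = 0 ↔ ∀ g x, f (ρ g x) = σ g (f x) := by
  simp only [funext_iff, equivarianceDefect_apply, Pi.zero_apply, sub_eq_zero, LinearMap.ext_iff,
    LinearMap.comp_apply]

end Commutator

/-! ### Self-extensions and derivations -/

section Extensions

variable {K R : Type*} [Field K] [Ring R] [Algebra K R]
  {B P : Type*} [AddCommGroup B] [Module K B] [Module R B] [IsScalarTower K R B]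
  [AddCommGroup P] [Module K P] [Module R P] [IsScalarTower K R P]

/-- A surjection of modules has a linear section commuting with a given complete family of
orthogonal idempotents. -/
theorem exists_section_comm_idempotents {ι : Type*} [Fintype ι] {e : ι → R}
    (he : CompleteOrthogonalIdempotents e) (p : P →ₗ[R] B) (hp : Function.Surjective p) :
    ∃ s : B →ₗ[K] P, (∀ b, p (s b) = b) ∧ ∀ i b, s (e i • b) = e i • s b := by
  classical
  obtain ⟨s, hs⟩ := (p.restrictScalars K).exists_rightInverse_of_surjective
    (LinearMap.range_eq_top.2 hp)
  have hs' : ∀ b, p (s b) = b := fun b => LinearMap.congr_fun hs b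
  -- Averaging an arbitrary linear section over the idempotents makes it commute with them.
  refine ⟨∑ i, Algebra.lsmul K K P (e i) ∘ₗ s ∘ₗ Algebra.lsmul K K B (e i), fun b => ?_,
    fun i b => ?_⟩
  · simp only [LinearMap.sum_apply, LinearMap.comp_apply, Algebra.lsmul_coe, map_sum, map_smul,
      hs', smul_smul, (he.idem _).eq]
    rw [← Finset.sum_smul, he.complete, one_smul]
  · simp only [LinearMap.sum_apply, LinearMap.comp_apply, Algebra.lsmul_coe, Finset.smul_sum,
      smul_smul, he.mul_eq]
    simp [ite_smul, apply_ite s]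

/-- If every derivation `R → End_K B` vanishing on a complete family of orthogonal idempotents is
inner, then homomorphisms to `B` extend from kernels of surjections onto `B`. -/
theorem exists_extension_of_derivation_inner {ι : Type*} [Fintype ι] {e : ι → R}
    (he : CompleteOrthogonalIdempotents e)
    (H : ∀ D : R →ₗ[K] Module.End K B,
      (∀ x y b, D (x * y) b = D x (y • b) + x • D y b) → (∀ i, D (e i) = 0) →
      ∃ φ : Module.End K B, ∀ x b, D x b = x • φ b - φ (x • b))
    (p : P →ₗ[R] B) (hp : Function.Surjective p) (h : LinearMap.ker p →ₗ[R] B) :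
    ∃ h' : P →ₗ[R] B, ∀ x : LinearMap.ker p, h' x = h x := by
  obtain ⟨s, hs, hse⟩ := exists_section_comm_idempotents (K := K) he p hp
  have hmem : ∀ (x : R) (b : B), x • s b - s (x • b) ∈ LinearMap.ker p := by
    intro x b; simp [LinearMap.mem_ker, hs]
  have hsmul : ∀ (c : K) (y : LinearMap.ker p), h (c • y) = c • h y := fun c y =>
    (h.restrictScalars K).map_smul c y
  -- The failure of `s` to be R-linear, pushed forward along `h`, is a derivation; it vanishes on
  -- the idempotents because `s` commutes with them.
  let D : R →ₗ[K] Module.End K B := LinearMap.mk₂ K (fun x b => h ⟨_, hmem x b⟩)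
    (fun x y b => by
      rw [← map_add]; congr 1; apply Subtype.ext
      simp [add_smul, add_sub_add_comm])
    (fun c x b => by
      rw [← hsmul]; congr 1; apply Subtype.ext
      simp [smul_sub])
    (fun x b b' => by
      rw [← map_add]; congr 1; apply Subtype.ext
      simp [add_sub_add_comm])
    (fun c x b => by
      rw [← hsmul]; congr 1; apply Subtype.ext
      simp [smul_sub, smul_comm x c])
  have hD : ∀ x b, D x b = h ⟨_, hmem x b⟩ := fun _ _ => rfl
  obtain ⟨φ, hφ⟩ := H D
    (fun x y b => by
      rw [hD, hD, hD, ← h.map_smul, ← h.map_add]; congr 1; apply Subtype.ext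
      simp [smul_sub, mul_smul])
    (fun i => by
      ext b
      rw [hD, LinearMap.zero_apply, ← map_zero h]; congr 1; apply Subtype.ext
      simp [hse])
  have hmem' : ∀ x : P, x - s (p x) ∈ LinearMap.ker p := by
    intro x; simp [LinearMap.mem_ker, hs]
  -- The section splits `P` linearly; the term `φ (p x)` cancels the derivation and restores
  -- R-linearity.
  refine ⟨{ toFun := fun x => h ⟨_, hmem' x⟩ + φ (p x), map_add' := fun x y => ?_,
            map_smul' := fun r x => ?_ }, fun x => ?_⟩
  · have : (⟨_, hmem' (x + y)⟩ : LinearMap.ker p) = ⟨_, hmem' x⟩ + ⟨_, hmem' y⟩ := by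
      apply Subtype.ext; simp [add_sub_add_comm]
    rw [this, map_add, map_add, map_add]; abel
  · have : (⟨_, hmem' (r • x)⟩ : LinearMap.ker p) =
        r • ⟨_, hmem' x⟩ + ⟨_, hmem r (p x)⟩ := by
      apply Subtype.ext; simp [smul_sub]
    rw [this, h.map_add, h.map_smul, ← hD, hφ, p.map_smul, RingHom.id_apply, smul_add]; abel
  · have hx : p x = 0 := x.2
    simp [hx]

end Extensions

/-- If homomorphisms to `Y` extend from kernels of surjections from free modules onto `X`, then
`Ext¹(X, Y) = 0`. -/
theorem ModuleCat.subsingleton_ext_one_of_extension {R : Type u} [Ring R] {X Y : Type u}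
    [AddCommGroup X] [Module R X] [AddCommGroup Y] [Module R Y]
    (H : ∀ (p : (X →₀ R) →ₗ[R] X), Function.Surjective p → ∀ h : LinearMap.ker p →ₗ[R] Y,
      ∃ h' : (X →₀ R) →ₗ[R] Y, ∀ x : LinearMap.ker p, h' x = h x) :
    Subsingleton (Abelian.Ext (ModuleCat.of R X) (ModuleCat.of R Y) 1) := by
  have hp : Function.Surjective (Finsupp.linearCombination R (id : X → X)) :=
    Finsupp.linearCombination_id_surjective R X
  have hS := LinearMap.shortExact_shortComplexKer hp
  refine subsingleton_of_forall_eq 0 fun x => ?_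
  have : Projective (LinearMap.shortComplexKer (Finsupp.linearCombination R (id : X → X))).X₂ :=
    ModuleCat.projective_of_free (Finsupp.basisSingleOne (R := R) (ι := X))
  -- Since the middle term is projective, every class comes from a map out of the kernel; such a map
  -- extends to the free module, so its class is zero.
  obtain ⟨y, rfl⟩ := Abelian.Ext.contravariant_sequence_exact₃ hS (ModuleCat.of R Y) x
    (Abelian.Ext.eq_zero_of_projective _) (n₀ := 0) rfl
  obtain ⟨f, rfl⟩ := Abelian.Ext.homEquiv₀.symm.surjective y
  obtain ⟨h', hh'⟩ := H _ hp f.hom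
  have hf : f = (LinearMap.shortComplexKer (Finsupp.linearCombination R (id : X → X))).f ≫
      ModuleCat.ofHom h' := by
    ext x
    exact (hh' x).symm
  rw [hf, Abelian.Ext.homEquiv₀_symm_apply, ← Abelian.Ext.mk₀_comp_mk₀]
  rw [← Abelian.Ext.comp_assoc_of_third_deg_zero, hS.extClass_comp, Abelian.Ext.zero_comp]

/-! ### Universal property and generators of the path algebra -/

namespace PathAlgebra

section Lift

variable {K : Type u} {V : Type v} [Quiver.{w} V] [Field K]
  {S : Type*} [Ring S] [Algebra K S]

/-- The value of a path under an assignment of ring elements to the vertices and the arrows. -/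
def pathValue (ρ : V → S) (σ : ∀ i j : V, (i ⟶ j) → S) {i : V} :
    ∀ {j : V}, Quiver.Path i j → S
  | _, .nil => ρ i
  | _, .cons p a => pathValue ρ σ p * σ _ _ a

variable {ρ : V → S} {σ : ∀ i j : V, (i ⟶ j) → S}

theorem pathValue_mul_target (hρ : OrthogonalIdempotents ρ) (hσ : ∀ i j a, σ i j a * ρ j = σ i j a)
    {i j : V} (p : Quiver.Path i j) : pathValue ρ σ p * ρ j = pathValue ρ σ p := by
  cases p with
  | nil => exact hρ.idem i
  | cons p a => simp only [pathValue, mul_assoc, hσ]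

theorem source_mul_pathValue (hρ : OrthogonalIdempotents ρ) {i j : V} (p : Quiver.Path i j) :
    ρ i * pathValue ρ σ p = pathValue ρ σ p := by
  induction p with
  | nil => exact hρ.idem i
  | cons p a ih => simp only [pathValue, ← mul_assoc, ih]

theorem pathValue_comp (hρ : OrthogonalIdempotents ρ) (hσ : ∀ i j a, σ i j a * ρ j = σ i j a)
    {i j k : V} (p : Quiver.Path i j) (q : Quiver.Path j k) :
    pathValue ρ σ (p.comp q) = pathValue ρ σ p * pathValue ρ σ q := by
  induction q with
  | nil => exact (pathValue_mul_target hρ hσ p).symm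
  | cons q a ih => simp only [Quiver.Path.comp_cons, pathValue, ih, mul_assoc]

variable [Fintype V]

/-- The homomorphism from the path algebra given by a complete family of orthogonal idempotents
`ρ i` and elements `σ a` for the arrows `a : i ⟶ j` with `σ a * ρ j = σ a`. -/
noncomputable def lift (hρ : CompleteOrthogonalIdempotents ρ) (hσ : ∀ i j a, σ i j a * ρ j = σ i j a) :
    PathAlgebra.{u, v, w} K V →ₐ[K] S :=
  AlgHom.ofLinearMap ((basis K).constr K fun p : QPath V => pathValue ρ σ p.path)
    (by
      rw [one_def, map_sum]
      simp only [vertex, ofPath, Module.Basis.constr_basis, pathValue]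
      exact hρ.complete)
    (by
      intro a b
      induction a using induction with
      | h0 => simp
      | hadd a a' ha ha' => rw [add_mul, map_add, ha, ha', map_add, add_mul]
      | hs x p =>
        induction b using induction with
        | h0 => simp
        | hadd b b' hb hb' => rw [mul_add, map_add, hb, hb', map_add, mul_add]
        | hs y q =>
          rw [smul_mul_assoc, mul_smul_comm]
          simp only [map_smul, smul_mul_assoc, mul_smul_comm]
          rw [smul_comm y x]
          refine congrArg (fun z : S => x • z) (congrArg (fun z : S => y • z) ?_)
          rw [ofPath_mul]
          obtain ⟨i, j, p⟩ := p
          obtain ⟨j', k, q⟩ := q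
          by_cases h : j' = j
          · subst h
            rw [pathMul_of_eq]
            simp only [ofPath, Module.Basis.constr_basis]
            exact pathValue_comp hρ.toOrthogonalIdempotents hσ p q
          · rw [pathMul_of_ne _ _ (by exact h), map_zero]
            simp only [ofPath, Module.Basis.constr_basis]
            -- For paths that do not compose, distinct orthogonal idempotents can be inserted
            -- between the two values.
            rw [← pathValue_mul_target hρ.toOrthogonalIdempotents hσ p,
              ← source_mul_pathValue hρ.toOrthogonalIdempotents q, mul_assoc, ← mul_assoc (ρ j),
              hρ.ortho (Ne.symm h), zero_mul, mul_zero])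

theorem lift_ofPath (hρ : CompleteOrthogonalIdempotents ρ)
    (hσ : ∀ i j a, σ i j a * ρ j = σ i j a) (p : QPath V) :
    lift hρ hσ (ofPath K p) = pathValue ρ σ p.path :=
  (basis K).constr_basis K _ p

end Lift

section Generators

variable (K : Type u) (V : Type v) [Quiver.{w} V] [Field K]

/-- The vertices and the arrows of the quiver, as elements of the opposite of the path algebra. -/
noncomputable def generator : V ⊕ (Σ i j : V, (i ⟶ j)) → (PathAlgebra.{u, v, w} K V)ᵐᵒᵖ
  | .inl i => .op (vertex K i)
  | .inr ⟨i, j, a⟩ => .op (ofPath K ⟨i, j, a.toPath⟩)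

theorem adjoin_range_generator [Fintype V] : Algebra.adjoin K (Set.range (generator K V)) = ⊤ := by
  have key : ∀ (i j : V) (p : Quiver.Path i j),
      MulOpposite.op (ofPath K ⟨i, j, p⟩) ∈ Algebra.adjoin K (Set.range (generator K V)) := by
    intro i j p
    induction p with
    | nil => exact Algebra.subset_adjoin ⟨.inl i, rfl⟩
    | cons p a ih =>
      have h := ofPath_mul (K := K) ⟨_, _, p⟩ ⟨_, _, a.toPath⟩
      rw [pathMul_of_eq] at h
      have h' : (ofPath K ⟨_, _, p.cons a⟩ : PathAlgebra.{u, v, w} K V) =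
          ofPath K ⟨_, _, p⟩ * ofPath K ⟨_, _, a.toPath⟩ := h.symm
      rw [h', MulOpposite.op_mul]
      exact mul_mem (Algebra.subset_adjoin ⟨.inr ⟨_, _, a⟩, rfl⟩) ih
  rw [eq_top_iff]
  rintro ⟨a⟩ -
  change MulOpposite.op a ∈ _
  induction a using induction with
  | h0 => exact zero_mem _
  | hadd a b ha hb => exact add_mem ha hb
  | hs c p => exact Subalgebra.smul_mem _ (key p.src p.tgt p.path) c

variable {V}

theorem vertex_mul_self (i : V) :
    vertex K i * vertex K i = (vertex K i : PathAlgebra.{u, v, w} K V) := by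
  rw [vertex, ofPath_mul, pathMul_of_eq, Quiver.Path.comp_nil]

theorem completeOrthogonalIdempotents_vertex [Fintype V] :
    CompleteOrthogonalIdempotents (vertex K : V → PathAlgebra.{u, v, w} K V) where
  idem := vertex_mul_self K
  ortho i j h := by
    exact (ofPath_mul _ _).trans (pathMul_of_ne _ _ h.symm)
  complete := rfl

theorem completeOrthogonalIdempotents_op_vertex [Fintype V] :
    CompleteOrthogonalIdempotents
      fun i : V => MulOpposite.op (vertex K i : PathAlgebra.{u, v, w} K V) where
  idem i := congrArg MulOpposite.op (vertex_mul_self K i)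
  ortho i j h := congrArg MulOpposite.op ((completeOrthogonalIdempotents_vertex K).ortho h.symm)
  complete := by
    rw [← Finset.op_sum]; rfl

theorem vertex_mul_ofPath {i j : V} (p : Quiver.Path i j) :
    vertex K i * ofPath K ⟨i, j, p⟩ = (ofPath K ⟨i, j, p⟩ : PathAlgebra.{u, v, w} K V) := by
  rw [vertex, ofPath_mul, pathMul_of_eq, Quiver.Path.nil_comp]

theorem ofPath_mul_vertex {i j : V} (p : Quiver.Path i j) :
    ofPath K ⟨i, j, p⟩ * vertex K j = (ofPath K ⟨i, j, p⟩ : PathAlgebra.{u, v, w} K V) := by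
  rw [vertex, ofPath_mul, pathMul_of_eq, Quiver.Path.comp_nil]

end Generators

end PathAlgebra

/-! ### Modules as representations of the quiver -/

namespace FinMod

variable {K : Type u} {V : Type v} [Quiver.{w} V] [Fintype V] [Field K]

/-- The actions of the vertices and the arrows of the quiver on a module. -/
noncomputable def action (X : FinMod.{u, v, w} K V) (g : V ⊕ (Σ i j : V, (i ⟶ j))) : Module.End K X :=
  Algebra.lsmul K K (X : Type (max u v w)) (PathAlgebra.generator K V g)

theorem action_apply (X : FinMod.{u, v, w} K V) (g : V ⊕ (Σ i j : V, (i ⟶ j))) (x : X) :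
    X.action g x = PathAlgebra.generator K V g • x := rfl

theorem generator_induction {P : (PathAlgebra.{u, v, w} K V)ᵐᵒᵖ → Prop}
    (hgen : ∀ g, P (PathAlgebra.generator K V g)) (halg : ∀ c : K, P (algebraMap K _ c))
    (hadd : ∀ r s, P r → P s → P (r + s)) (hmul : ∀ r s, P r → P s → P (r * s))
    (r : (PathAlgebra.{u, v, w} K V)ᵐᵒᵖ) : P r := by
  have hr : r ∈ Algebra.adjoin K (Set.range (PathAlgebra.generator K V)) := by
    rw [PathAlgebra.adjoin_range_generator]; trivial
  induction hr using Algebra.adjoin_induction with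
  | mem x hx => obtain ⟨g, rfl⟩ := hx; exact hgen g
  | algebraMap c => exact halg c
  | add x y _ _ hx hy => exact hadd x y hx hy
  | mul x y _ _ hx hy => exact hmul x y hx hy

theorem exists_hom_of_equivarianceDefect_eq_zero {X Y : FinMod.{u, v, w} K V} {f : X →ₗ[K] Y}
    (hf : equivarianceDefect X.action Y.action f = 0) : ∃ f' : Hom X Y, ∀ x, f' x = f x := by
  rw [equivarianceDefect_eq_zero_iff] at hf
  refine ⟨{ toFun := f, map_add' := f.map_add, map_smul' := fun r => ?_ }, fun _ => rfl⟩
  induction r using generator_induction with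
  | hgen g => exact hf g
  | halg c => intro x; rw [RingHom.id_apply, algebraMap_smul, algebraMap_smul, map_smul]
  | hadd r s hr hs => intro x; rw [add_smul, map_add, hr, hs, RingHom.id_apply, RingHom.id_apply,
      RingHom.id_apply, add_smul]
  | hmul r s hr hs => intro x; rw [mul_smul, hr, hs, RingHom.id_apply, RingHom.id_apply,
      RingHom.id_apply, mul_smul]

theorem equivarianceDefect_restrictScalars {X Y : FinMod.{u, v, w} K V} (f : Hom X Y) :
    equivarianceDefect X.action Y.action (f.restrictScalars K) = 0 :=
  equivarianceDefect_eq_zero_iff.2 fun _ _ => map_smul f _ _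

theorem hom_eq_zero_of_injective {X Y : FinMod.{u, v, w} K V}
    (h : Function.Injective (equivarianceDefect X.action Y.action)) (f : Hom X Y) : f = 0 := by
  have hf : f.restrictScalars K = 0 :=
    h ((equivarianceDefect_restrictScalars f).trans (map_zero _).symm)
  ext x
  exact LinearMap.congr_fun hf x

theorem eq_zero_of_equivarianceDefect_eq_zero {X Y : FinMod.{u, v, w} K V}
    (h : ∀ f : Hom X Y, f = 0) {f : X →ₗ[K] Y}
    (hf : equivarianceDefect X.action Y.action f = 0) : f = 0 := by
  obtain ⟨f', hf'⟩ := exists_hom_of_equivarianceDefect_eq_zero hf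
  ext x
  rw [← hf', h f']; rfl

theorem IsBrick.exists_smul {B : FinMod.{u, v, w} K V} (hB : B.IsBrick) {f : Module.End K B}
    (hf : equivarianceDefect B.action B.action f = 0) : ∃ c : K, f = c • LinearMap.id := by
  obtain ⟨e⟩ := hB
  obtain ⟨f', hf'⟩ := exists_hom_of_equivarianceDefect_eq_zero hf
  refine ⟨e f', LinearMap.ext fun x => ?_⟩
  have h : f' = algebraMap K _ (e f') := e.injective (by rw [AlgEquiv.commutes]; rfl)
  rw [← hf', h]
  simp

theorem IsBrick.nontrivial {B : FinMod.{u, v, w} K V} (hB : B.IsBrick) : Nontrivial B := by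
  obtain ⟨e⟩ := hB
  by_contra h
  rw [not_nontrivial_iff_subsingleton] at h
  have : (1 : Module.End (PathAlgebra.{u, v, w} K V)ᵐᵒᵖ B) = 0 :=
    LinearMap.ext fun _ => Subsingleton.elim _ _
  have h1 := congrArg e this
  rw [map_one, map_zero] at h1
  exact one_ne_zero h1

theorem isBrick_of_forall_exists_smul {X : FinMod.{u, v, w} K V} [Nontrivial X]
    (h : ∀ f : Module.End K X, equivarianceDefect X.action X.action f = 0 →
      ∃ c : K, f = c • LinearMap.id) : X.IsBrick := by
  refine ⟨(AlgEquiv.ofBijective (Algebra.ofId K _) ⟨?_, fun f => ?_⟩).symm⟩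
  · exact (algebraMap K (Module.End (PathAlgebra.{u, v, w} K V)ᵐᵒᵖ X)).injective
  · obtain ⟨c, hc⟩ := h _ (equivarianceDefect_restrictScalars f)
    refine ⟨c, LinearMap.ext fun x => ?_⟩
    have := LinearMap.congr_fun hc x
    rw [Algebra.ofId_apply, Module.algebraMap_end_apply]
    exact this.symm

/-- A brick which is not exceptional has a self-extension: a family of endomorphisms indexed by the
arrows of the quiver that is not the equivariance defect of a linear map. -/
theorem IsBrick.exists_cocycle {B : FinMod.{u, v, w} K V} (hB : B.IsBrick)
    (hexc : ¬ B.IsExceptional) :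
    ∃ δ : V ⊕ (Σ i j : V, (i ⟶ j)) → Module.End K B, (∀ i, δ (.inl i) = 0) ∧
      (∀ i j a b, δ (.inr ⟨i, j, a⟩) (B.action (.inl i) b) = δ (.inr ⟨i, j, a⟩) b ∧
    B.action (.inl j) (δ (.inr ⟨i, j, a⟩) b) = δ (.inr ⟨i, j, a⟩) b) ∧
      ∀ f, equivarianceDefect B.action B.action f ≠ δ := by
  by_contra! hcon
  refine hexc ⟨hB, ModuleCat.subsingleton_ext_one_of_extension fun p hp h => ?_⟩
  refine exists_extension_of_derivation_inner (K := K)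
    (PathAlgebra.completeOrthogonalIdempotents_op_vertex K) (fun D hD hDe => ?_) p hp h
  -- The source and target conditions come from the Leibniz rule applied to e_i a = a = a e_j, with
  -- `D` zero on vertices.
  obtain ⟨f, hf⟩ := hcon (fun g => D (PathAlgebra.generator K V g)) hDe (fun i j a b => by
    have h0 := hD (.op (PathAlgebra.ofPath K ⟨i, j, a.toPath⟩)) (.op (PathAlgebra.vertex K i)) b
    rw [← MulOpposite.op_mul, PathAlgebra.vertex_mul_ofPath, hDe, LinearMap.zero_apply,
      smul_zero, add_zero] at h0
    have h1 := hD (.op (PathAlgebra.vertex K j)) (.op (PathAlgebra.ofPath K ⟨i, j, a.toPath⟩)) b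
    rw [← MulOpposite.op_mul, PathAlgebra.ofPath_mul_vertex, hDe, LinearMap.zero_apply,
      zero_add] at h1
    exact ⟨h0.symm, h1.symm⟩)
  have hf' : ∀ g b, D (PathAlgebra.generator K V g) b =
      f (PathAlgebra.generator K V g • b) - PathAlgebra.generator K V g • f b := fun g b =>
    (LinearMap.congr_fun (congrFun hf g) b).symm
  -- Both sides obey the same Leibniz rule, so agreement on generators suffices.
  have key : ∀ x b, D x b = f (x • b) - x • f b := by
    intro x
    induction x using generator_induction with
    | hgen g => exact hf' g
    | halg c =>
      intro b
      have h1 : D 1 b = 0 := by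
        have := hD 1 1 b
        rw [mul_one, one_smul, one_smul] at this
        simpa using this
      rw [Algebra.algebraMap_eq_smul_one, map_smul, LinearMap.smul_apply, h1]
      simp
    | hadd r s hr hs =>
      intro b
      rw [map_add, LinearMap.add_apply, hr, hs, add_smul, add_smul, map_add]
      abel
    | hmul r s hr hs =>
      intro b
      rw [hD, hr, hs, smul_sub, mul_smul, mul_smul]
      abel
  refine ⟨-f, fun x b => ?_⟩
  rw [key, LinearMap.neg_apply, LinearMap.neg_apply, smul_neg]
  abel

/-! ### Deformation along a family of maps -/

section Deform

variable (B : FinMod.{u, v, w} K V) (δ : V ⊕ (Σ i j : V, (i ⟶ j)) → Module.End K B)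
  (hδ : ∀ i j a b, δ (.inr ⟨i, j, a⟩) (B.action (.inl i) b) = δ (.inr ⟨i, j, a⟩) b ∧
    B.action (.inl j) (δ (.inr ⟨i, j, a⟩) b) = δ (.inr ⟨i, j, a⟩) b) (t : K)

include hδ in
-- Compatibility with the target idempotent is the only condition `PathAlgebra.lift` puts on arrows;
-- no relation among arrows restricts `δ` or t.
theorem deform_arrow_mul_vertex (i j : V) (a : i ⟶ j) :
    MulOpposite.op (B.action (.inr ⟨i, j, a⟩) + t • δ (.inr ⟨i, j, a⟩)) *
      MulOpposite.op (B.action (.inl j)) =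
    MulOpposite.op (B.action (.inr ⟨i, j, a⟩) + t • δ (.inr ⟨i, j, a⟩)) := by
  rw [← MulOpposite.op_mul]
  congr 1
  ext b
  simp only [Module.End.mul_apply, LinearMap.add_apply, LinearMap.smul_apply, map_add, map_smul, (hδ i j a b).2]
  congr 1
  rw [action_apply, action_apply, ← mul_smul, PathAlgebra.generator, PathAlgebra.generator,
    ← MulOpposite.op_mul, PathAlgebra.ofPath_mul_vertex]

theorem completeOrthogonalIdempotents_op_action :
    CompleteOrthogonalIdempotents fun i : V => MulOpposite.op (B.action (.inl i)) :=
  (PathAlgebra.completeOrthogonalIdempotents_vertex K).map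
    (AlgHom.opComm.symm (Algebra.lsmul K K (B : Type (max u v w)))).toRingHom

/-- The action of the path algebra in which the arrows act on `B` by their action deformed
by `t • δ`. -/
noncomputable def deformAlgHom : (PathAlgebra.{u, v, w} K V)ᵐᵒᵖ →ₐ[K] Module.End K B :=
  AlgHom.opComm (PathAlgebra.lift (B.completeOrthogonalIdempotents_op_action)
    (B.deform_arrow_mul_vertex δ hδ t))

/-- The module on the vector space `B` in which the arrows act by their action on `B` deformed
by `t • δ`. -/
noncomputable def deform : FinMod.{u, v, w} K V :=
  letI := Module.compHom B (B.deformAlgHom δ hδ t).toRingHom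
  { carrier := B
    isScalarTower := ⟨fun c r x => by
      change (B.deformAlgHom δ hδ t (c • r)) x = c • (B.deformAlgHom δ hδ t r) x
      rw [map_smul, LinearMap.smul_apply]⟩ }

theorem deformAlgHom_vertex (i : V) :
    B.deformAlgHom δ hδ t (.op (PathAlgebra.vertex K i)) = B.action (.inl i) :=
  congrArg MulOpposite.unop (PathAlgebra.lift_ofPath
    B.completeOrthogonalIdempotents_op_action (B.deform_arrow_mul_vertex δ hδ t) _)

theorem deformAlgHom_arrow {i j : V} (a : i ⟶ j) :
    B.deformAlgHom δ hδ t (.op (PathAlgebra.ofPath K ⟨i, j, a.toPath⟩)) =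
      B.action (.inr ⟨i, j, a⟩) + t • δ (.inr ⟨i, j, a⟩) := by
  refine (congrArg MulOpposite.unop (PathAlgebra.lift_ofPath
    B.completeOrthogonalIdempotents_op_action (B.deform_arrow_mul_vertex δ hδ t) _)).trans ?_
  change MulOpposite.unop (MulOpposite.op (B.action (.inl i)) * MulOpposite.op _) = _
  rw [← MulOpposite.op_mul, MulOpposite.unop_op]
  ext b
  simp only [Module.End.mul_apply, LinearMap.add_apply, LinearMap.smul_apply, (hδ i j a b).1]
  congr 1
  rw [action_apply, action_apply, ← mul_smul, PathAlgebra.generator, PathAlgebra.generator,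
    ← MulOpposite.op_mul, PathAlgebra.vertex_mul_ofPath]
  rfl

theorem action_deform (hδ' : ∀ i, δ (.inl i) = 0) :
    (B.deform δ hδ t).action = B.action + t • δ := by
  funext g
  rcases g with i | ⟨i, j, a⟩
  · refine (B.deformAlgHom_vertex δ hδ t i).trans ?_
    simp [hδ']
  · exact B.deformAlgHom_arrow δ hδ t a

/-- The idempotents at the vertices act as before. -/
theorem dimVec_deform : (B.deform δ hδ t).dimVec = B.dimVec := by
  funext i
  have h : (B.deform δ hδ t).component i = B.component i :=
    congrArg LinearMap.range (B.deformAlgHom_vertex δ hδ t i)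
  exact congrArg (fun S : Submodule K B => Module.finrank K S) h

end Deform

theorem mem_leftPerp_directSum {X M N : FinMod.{u, v, w} K V} (hM : X ∈ M.leftPerp)
    (hN : X ∈ N.leftPerp) : X ∈ (M.directSum N).leftPerp := by
  intro f
  let f' : X →ₗ[(PathAlgebra.{u, v, w} K V)ᵐᵒᵖ] M × N := f
  have h1 := hM (LinearMap.fst _ M N ∘ₗ f')
  have h2 := hN (LinearMap.snd _ M N ∘ₗ f')
  refine LinearMap.ext fun x => Prod.ext (LinearMap.congr_fun h1 x) (LinearMap.congr_fun h2 x)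

theorem mem_rightPerp_directSum {X M N : FinMod.{u, v, w} K V} (hM : X ∈ M.rightPerp)
    (hN : X ∈ N.rightPerp) : X ∈ (M.directSum N).rightPerp := by
  intro f
  let f' : M × N →ₗ[(PathAlgebra.{u, v, w} K V)ᵐᵒᵖ] X := f
  have h1 := hM (f' ∘ₗ LinearMap.inl _ M N)
  have h2 := hN (f' ∘ₗ LinearMap.inr _ M N)
  have h : f' = 0 := LinearMap.prod_ext h1 h2
  exact h

end FinMod

/-! ### Properties of almost all deformations -/

namespace FinMod

variable {K : Type u} {V : Type v} [Quiver.{w} V] [Fintype V] [Field K]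

/-- Scalars always commute with the action, so they must be split off before injectivity of the
defect can express the brick property. The complement `C` can be kept fixed while the action varies.
-/
theorem isBrick_of_isCompl {X : FinMod.{u, v, w} K V} [Nontrivial X]
    {C : Submodule K (Module.End K X)} (hC : IsCompl (K ∙ (LinearMap.id : Module.End K X)) C)
    (hinj : Function.Injective (equivarianceDefect X.action X.action ∘ₗ C.subtype)) :
    X.IsBrick := by
  refine isBrick_of_forall_exists_smul fun f hf => ?_
  obtain ⟨x, hx, y, hy, rfl⟩ := Submodule.mem_sup.1
    (hC.sup_eq_top ▸ Submodule.mem_top : f ∈ (K ∙ (LinearMap.id : Module.End K X)) ⊔ C)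
  obtain ⟨c, rfl⟩ := Submodule.mem_span_singleton.1 hx
  have hid : equivarianceDefect X.action X.action (c • LinearMap.id) = 0 :=
    equivarianceDefect_eq_zero_iff.2 fun g x => by simp
  rw [map_add, hid, zero_add] at hf
  have hy' : y = 0 := congrArg Subtype.val (hinj (a₁ := ⟨y, hy⟩) (hf.trans (map_zero _).symm))
  exact ⟨c, by rw [hy', add_zero]⟩

section Deform

variable (B : FinMod.{u, v, w} K V) (δ : V ⊕ (Σ i j : V, (i ⟶ j)) → Module.End K B)
  (hδ₀ : ∀ i, δ (.inl i) = 0)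
  (hδ : ∀ i j a b, δ (.inr ⟨i, j, a⟩) (B.action (.inl i) b) = δ (.inr ⟨i, j, a⟩) b ∧
    B.action (.inl j) (δ (.inr ⟨i, j, a⟩) b) = δ (.inr ⟨i, j, a⟩) b)

include hδ₀

/-- If `Hom(B, Y)` satisfies the criterion for pencils, then `Hom` from almost all deformations of
`B` to `Y` vanishes. -/
theorem finite_setOf_deform_notMem_leftPerp (Y : FinMod.{u, v, w} K V)
    (h : ∀ f f' : B →ₗ[K] Y, equivarianceDefect B.action Y.action f = 0 →
      equivarianceDefect δ 0 f = equivarianceDefect B.action Y.action f' → f = 0) :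
    {t : K | B.deform δ hδ t ∉ Y.leftPerp}.Finite := by
  refine (LinearMap.finite_setOf_not_injective_add_smul_of_ker _ _ h).subset fun t ht hinj => ht ?_
  rw [← equivarianceDefect_add_smul, smul_zero, add_zero, ← B.action_deform δ hδ t hδ₀] at hinj
  exact fun f => hom_eq_zero_of_injective (X := B.deform δ hδ t) hinj f

/-- If `Hom(Y, B)` satisfies the criterion for pencils, then `Hom` from `Y` to almost all
deformations of `B` vanishes. -/
theorem finite_setOf_deform_notMem_rightPerp (Y : FinMod.{u, v, w} K V)
    (h : ∀ f f' : Y →ₗ[K] B, equivarianceDefect Y.action B.action f = 0 →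
      equivarianceDefect 0 δ f = equivarianceDefect Y.action B.action f' → f = 0) :
    {t : K | B.deform δ hδ t ∉ Y.rightPerp}.Finite := by
  refine (LinearMap.finite_setOf_not_injective_add_smul_of_ker _ _ h).subset fun t ht hinj => ht ?_
  rw [← equivarianceDefect_add_smul, smul_zero, add_zero, ← B.action_deform δ hδ t hδ₀] at hinj
  exact fun f => hom_eq_zero_of_injective (Y := B.deform δ hδ t) hinj f

/-- Almost all deformations of a brick are bricks. -/
theorem IsBrick.finite_setOf_not_isBrick_deform (hB : B.IsBrick) :
    {t : K | ¬ (B.deform δ hδ t).IsBrick}.Finite := by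
  have := hB.nontrivial
  obtain ⟨C, hC⟩ := (K ∙ (LinearMap.id : Module.End K B)).exists_isCompl
  have hinj : Function.Injective (equivarianceDefect B.action B.action ∘ₗ C.subtype) := by
    rw [injective_iff_map_eq_zero]
    rintro ⟨f, hfC⟩ hf
    obtain ⟨c, hc⟩ := hB.exists_smul hf
    exact Subtype.ext (Submodule.disjoint_def.1 hC.disjoint f
      (Submodule.mem_span_singleton.2 ⟨c, hc.symm⟩) hfC)
  refine (LinearMap.finite_setOf_not_injective_add_smul _
    (equivarianceDefect δ δ ∘ₗ C.subtype) hinj).subset fun t ht hinj => ht ?_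
  rw [← LinearMap.smul_comp, ← LinearMap.add_comp, ← equivarianceDefect_add_smul,
    ← B.action_deform δ hδ t hδ₀] at hinj
  have : Nontrivial (B.deform δ hδ t) := hB.nontrivial
  exact isBrick_of_isCompl (X := B.deform δ hδ t) hC hinj

end Deform

end FinMod

/-! ### Choice of the parameter -/

theorem mainTheorem7 (K : Type u) [Field K] [IsAlgClosed K]
    (V : Type v) [Quiver.{w} V] [Fintype V] [∀ i j : V, Finite (i ⟶ j)]
    (hV : QuiverAcyclic.{v, w} V)
    (M N B : FinMod.{u, v, w} K V)
    (hB : B ∈ M.leftPerp ∩ N.rightPerp)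
    (hbrick : B.IsBrick) (hexc : ¬ B.IsExceptional) :
    ∃ B' : FinMod.{u, v, w} K V,
      B'.IsBrick ∧
      B' ∈ (M.directSum B).leftPerp ∩ (N.directSum B).rightPerp ∧
      ∃ n : ℕ, 1 ≤ n ∧ B'.dimVec = n • B.dimVec := by
  obtain ⟨δ, hδ₀, hδ, hδ'⟩ := hbrick.exists_cocycle hexc
  have hM := B.finite_setOf_deform_notMem_leftPerp δ hδ₀ hδ M
    fun f _ hf _ => FinMod.eq_zero_of_equivarianceDefect_eq_zero hB.1 hf
  have hN := B.finite_setOf_deform_notMem_rightPerp δ hδ₀ hδ N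
    fun f _ hf _ => FinMod.eq_zero_of_equivarianceDefect_eq_zero hB.2 hf
  have hBl := B.finite_setOf_deform_notMem_leftPerp δ hδ₀ hδ B fun f f' hf hf' => by
    obtain ⟨c, rfl⟩ := hbrick.exists_smul hf
    by_contra hc
    have hc0 : c ≠ 0 := by
      rintro rfl
      exact hc (zero_smul _ _)
    -- A nonzero scalar c in the kernel would give c `δ` as the defect of `f'`, making `δ` a
    -- coboundary.
    refine hδ' (c⁻¹ • f') ?_
    rw [map_smul, ← hf', map_smul, smul_smul, inv_mul_cancel₀ hc0, one_smul]
    ext g x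
    simp [equivarianceDefect_apply]
  have hBr := B.finite_setOf_deform_notMem_rightPerp δ hδ₀ hδ B fun f f' hf hf' => by
    obtain ⟨c, rfl⟩ := hbrick.exists_smul hf
    by_contra hc
    have hc0 : c ≠ 0 := by
      rintro rfl
      exact hc (zero_smul _ _)
    -- Deforming the target instead of the source changes the sign of `δ`.
    refine hδ' (-(c⁻¹ • f')) ?_
    rw [map_neg, map_smul, ← hf', map_smul, smul_smul, inv_mul_cancel₀ hc0, one_smul]
    ext g x
    simp [equivarianceDefect_apply]
  have hbr := hbrick.finite_setOf_not_isBrick_deform B δ hδ₀ hδ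
  -- An algebraically closed field is infinite, so a parameter outside the finite union exists.
  obtain ⟨t, ht⟩ := ((((hM.union hN).union hBl).union hBr).union hbr).exists_notMem
  simp only [Set.mem_union, Set.mem_ofPred_eq, not_or, not_not] at ht
  obtain ⟨⟨⟨⟨h1, h2⟩, h3⟩, h4⟩, h5⟩ := ht
  exact ⟨B.deform δ hδ t, h5,
    ⟨FinMod.mem_leftPerp_directSum h1 h3, FinMod.mem_rightPerp_directSum h2 h4⟩, 1, le_rfl,
    (B.dimVec_deform δ hδ t).trans (one_smul _ _).symm⟩
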